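/- Let $n\in\mathbb N$, let $m$ be an even positive integer and let $k$ be an odd integer with $0<k<m/2$. Equip $\mathbb Z_m^n$ with the metric $d(x,y)=\max_{1\le i\le n}|x_i-y_i|$, where $|z|=\min\{z,m-z\}$ for $z\in\mathbb Z_m$ (identified with $\{0,\dots,m-1\}$), let $e_1,\dots,e_n$ be its standard basis, and put $$L=\{y\in\mathbb Z_m^n:\ y_i \text{ is even for all } i,\ d(0,y)<k\}.$$ For a Banach space $X$ and $f:\mathbb Z_m^n\to X$ let $\Delta_{[n]}f(x)=\frac1{|L|}\sum_{y\in L}f(x+y)$. The space $X$ has Rademacher type $p\ge 1$ if there is $T\in[0,\infty)$ such that $\mathbb E_\varepsilon\|\sum_{j=1}^N\varepsilon_jx_j\|^p\le T^p\sum_{j=1}^N\|x_j\|^p$ for all $N$ and all $x_1,\dots,x_N\in X$, where $\varepsilon$ is uniform in $\{-1,1\}^N$; the smallest such $T$ is denoted $T_p(X)$. Lemma. For every $c>0$ there is a function $K_c$ of two real variables such that the following holds. Let $X$ be a Banach space with Rademacher type $p\ge1$, and let $n,m,k$ be as above with $k\ge c\,n\log n$. Then for every $f:\mathbb Z_m^n\to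 X$, $$\mathbb E_{x,\varepsilon}\Big[\big\|\Delta_{[n]}f(x+\varepsilon)-\Delta_{[n]}f(x-\varepsilon)\big\|_X^p\Big]\le K_c\big(p,T_p(X)\big)\sum_{j=1}^n\mathbb E_x\Big[\|f(x+e_j)-f(x)\|_X^p\Big],$$ where $x$ is uniform in $\mathbb Z_m^n$ and $\varepsilon$ is uniform in $\{-1,1\}^n$, independently of $x$. -/

import Mathlib

open scoped BigOperators

noncomputable section

namespace ScaledEnflo

/-- The Rademacher type `p` inequality with constant `T`: for all finite families of vectors,
`𝔼 ‖∑ⱼ εⱼ xⱼ‖ ^ p ≤ T ^ p * ∑ⱼ ‖xⱼ‖ ^ p`, the signs `ε` being uniform in `{-1, 1}ⁿ`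
(the units of `ℤ` are exactly `1` and `-1`). -/
def RademacherTypeWith (p T : ℝ) (X : Type*) [NormedAddCommGroup X] [NormedSpace ℝ X] : Prop :=
  ∀ (n : ℕ) (x : Fin n → X),
    Finset.expect Finset.univ
        (fun ε : Fin n → ℤˣ => ‖∑ j, (((ε j : ℤ) : ℝ)) • x j‖ ^ p)
      ≤ T ^ p * ∑ j, ‖x j‖ ^ p

/-- `X` has Rademacher type `p`, where `p ≥ 1`. -/
def HasRademacherType (p : ℝ) (X : Type*) [NormedAddCommGroup X] [NormedSpace ℝ X] : Prop :=
  1 ≤ p ∧ ∃ T : ℝ, 0 ≤ T ∧ RademacherTypeWith p T X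

/-- `T_p(X)`, the smallest constant `T ≥ 0` in the Rademacher type `p` inequality. -/
def rademacherConst (p : ℝ) (X : Type*) [NormedAddCommGroup X] [NormedSpace ℝ X] : ℝ :=
  sInf {T : ℝ | 0 ≤ T ∧ RademacherTypeWith p T X}

/-- The infimum defining `T_p(X)` is attained, so that it is indeed the smallest constant. -/
theorem HasRademacherType.isLeast {p : ℝ} {X : Type*} [NormedAddCommGroup X] [NormedSpace ℝ X]
    (h : HasRademacherType p X) :
    IsLeast {T : ℝ | 0 ≤ T ∧ RademacherTypeWith p T X} (rademacherConst p X) := by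
  have hb : BddBelow {T : ℝ | 0 ≤ T ∧ RademacherTypeWith p T X} := ⟨0, fun T hT => hT.1⟩
  refine ⟨IsClosed.csInf_mem ?_ h.2 hb, fun T hT => csInf_le hb hT⟩
  have hp : 0 ≤ p := zero_le_one.trans h.1
  refine isClosed_Ici.inter ?_
  have : {T : ℝ | RademacherTypeWith p T X} = ⋂ (n : ℕ), ⋂ (x : Fin n → X),
      {T : ℝ | Finset.expect Finset.univ
        (fun ε : Fin n → ℤˣ => ‖∑ j, (((ε j : ℤ) : ℝ)) • x j‖ ^ p)
      ≤ T ^ p * ∑ j, ‖x j‖ ^ p} := by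
    ext T
    simp [RademacherTypeWith]
  change IsClosed {T : ℝ | RademacherTypeWith p T X}
  rw [this]
  refine isClosed_iInter fun n => isClosed_iInter fun x => isClosed_le continuous_const ?_
  exact (Real.continuous_rpow_const hp).mul continuous_const

/-- The `ℓ_∞` distance on `ℤ_mⁿ` built from the cyclic distance `|z| = min (z, m - z)` on `ℤ_m`. -/
def torusDist {n m : ℕ} (x y : Fin n → ZMod m) : ℕ :=
  Finset.univ.sup fun i => (x i - y i).valMinAbs.natAbs

/-- A sign vector `ε ∈ {-1, 1}ⁿ` viewed as an element of `ℤ_mⁿ`. -/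
def signVec {n : ℕ} (m : ℕ) (ε : Fin n → ℤˣ) : Fin n → ZMod m :=
  fun j => ((ε j : ℤ) : ZMod m)

open Classical in
/-- `L_B`: the points of `ℤ_mⁿ` that vanish off `B`, have only even coordinates (the
modulus `m` being even), and lie at distance less than `k` from the origin. -/
def evenBox {n m : ℕ} [NeZero m] (k : ℕ) (B : Finset (Fin n)) : Finset (Fin n → ZMod m) :=
  Finset.univ.filter fun y =>
    (∀ i, i ∉ B → y i = 0) ∧ (∀ i, Even (y i)) ∧ torusDist 0 y < k

/-- `Δ_B f (x)`, the average of `f (x + y)` over `y ∈ L_B`. -/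
def smoothing {n m : ℕ} [NeZero m] {X : Type*} [NormedAddCommGroup X] [NormedSpace ℝ X]
    (k : ℕ) (B : Finset (Fin n)) (f : (Fin n → ZMod m) → X) (x : Fin n → ZMod m) : X :=
  (((evenBox k B : Finset (Fin n → ZMod m)).card : ℝ))⁻¹ • ∑ y ∈ evenBox k B, f (x + y)

end ScaledEnflo

end

/-!
Rademacher type `p` implies Enflo type `p` on the discrete cube (the theorem of Ivanisvili,
van Handel and Volberg): for every `f : {-1, 1}ⁿ → X`,
`𝔼 ‖f ε - f (-ε)‖ ^ p ≤ (4 p T) ^ p ∑ⱼ 𝔼 ‖Dⱼ f ε‖ ^ p`, where `T = T_p(X)` and `Dⱼ` is the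
discrete derivative (`RademacherTypeWith.sum_norm_sub_neg_rpow_le`). The lemma follows by applying
this to `ε ↦ Δ f (x + ε)` for each `x` and averaging over `x`: the averaging operator `Δ` is a
contraction in `L_p` that commutes with translations, and flipping one coordinate of `ε` moves
`x + ε` by `±2 eⱼ`, that is, by two unit steps. So `K_c (p, T) = (4 p T) ^ p` works.

For the cube inequality, let `P_r f ε = 𝔼 f (ε ξ)`, where `ξ` has independent `±1` coordinates of
mean `r`. Then `P_1 f = f`, and `P_0 f` is the mean of `f`. Differentiating the density of `ξ` gives
`d/dr P_r f ε = 𝔼_ξ ∑ⱼ δⱼ Dⱼ f (ε ξ)` with the scores `δⱼ = ξⱼ / (1 + r ξⱼ)`, which are independent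
and centred. Since `ε ξ` is uniform and independent of `ξ`, symmetrization and type `p`
(`RademacherTypeWith.sum_centered_le`) bound the `L_p` norm of this derivative by
`2 T (𝔼 |δ| ^ p) ^ (1 / p) (∑ⱼ 𝔼 ‖Dⱼ f‖ ^ p) ^ (1 / p)`, and
`(𝔼 |δ| ^ p) ^ (1 / p) ≤ (1 - r) ^ (1 / p - 1)`, whose integral over `[0, 1]` is `p`.
-/

open Finset

namespace ScaledEnflo

variable {X : Type*} [NormedAddCommGroup X] [NormedSpace ℝ X] {p : ℝ}

/-! ### Convexity of the `p`-th power of the norm -/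

theorem norm_rpow_sum_le {ι : Type*} (s : Finset ι) (hp : 1 ≤ p) (w : ι → ℝ)
    (hw : ∀ i ∈ s, 0 ≤ w i) (hw1 : ∑ i ∈ s, w i = 1) (v : ι → X) :
    ‖∑ i ∈ s, w i • v i‖ ^ p ≤ ∑ i ∈ s, w i * ‖v i‖ ^ p := by
  have h1 : ‖∑ i ∈ s, w i • v i‖ ≤ ∑ i ∈ s, w i * ‖v i‖ := by
    refine (norm_sum_le _ _).trans (sum_le_sum fun i hi => ?_)
    rw [norm_smul, Real.norm_of_nonneg (hw i hi)]
  exact (Real.rpow_le_rpow (norm_nonneg _) h1 (by linarith)).trans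
    (Real.rpow_arith_mean_le_arith_mean_rpow s w _ hw hw1 (fun i _ => norm_nonneg _) hp)

theorem norm_sub_rpow_le (hp : 1 ≤ p) (a b : X) :
    ‖a - b‖ ^ p ≤ 2 ^ p * ((‖a‖ ^ p + ‖b‖ ^ p) / 2) := by
  have h := norm_rpow_sum_le univ hp (fun _ : Fin 2 => (1 / 2 : ℝ)) (by intros; positivity)
    (by norm_num) ![a, -b]
  simp only [Fin.sum_univ_two, Matrix.cons_val_zero, Matrix.cons_val_one, norm_neg] at h
  have h2 : a - b = (2 : ℝ) • ((1 / 2 : ℝ) • a + (1 / 2 : ℝ) • -b) := by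
    module
  rw [h2, norm_smul, Real.mul_rpow (norm_nonneg _) (norm_nonneg _), Real.norm_two]
  exact mul_le_mul_of_nonneg_left (by linarith) (by positivity)

/-! ### Type inequality for independent centred variables -/

theorem sum_prod_eq_one {n : ℕ} (a : ℤˣ → ℝ) (ha : ∑ t, a t = 1) :
    ∑ ξ : Fin n → ℤˣ, ∏ i, a (ξ i) = 1 := by
  rw [← Fintype.prod_sum fun _ : Fin n => a]
  rw [ha, prod_const, one_pow]

theorem sum_prod_mul_apply {n : ℕ} (a h : ℤˣ → ℝ) (ha : ∑ t, a t = 1) (j : Fin n) :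
    ∑ ξ : Fin n → ℤˣ, (∏ i, a (ξ i)) * h (ξ j) = ∑ t, a t * h t := by
  have h1 : ∀ ξ : Fin n → ℤˣ, (∏ i, a (ξ i)) * h (ξ j)
      = ∏ i, a (ξ i) * (if i = j then h (ξ i) else 1) := by
    intro ξ
    rw [prod_mul_distrib, prod_ite_eq' univ j fun i => h (ξ i)]
    simp
  simp_rw [h1]
  rw [← Fintype.prod_sum fun (i : Fin n) (t : ℤˣ) => a t * (if i = j then h t else 1),
    prod_eq_single j]
  · simp
  · intro i _ hi
    simpa only [hi, if_false, mul_one] using ha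
  · simp

/-- If `ξ` and `ζ` are independent copies with i.i.d. coordinates of law `a`, then the differences
`δ (ξ j) - δ (ζ j)` are symmetric: exchanging `ξ j` and `ζ j` at those `j` where `σ j = -1` absorbs
the signs `σ`. -/
theorem norm_signed_sum_rpow_eq {n : ℕ} (a δ : ℤˣ → ℝ) (x : Fin n → X) (σ : Fin n → ℤˣ) :
    ∑ q : (Fin n → ℤˣ) × (Fin n → ℤˣ), (∏ i, a (q.1 i)) * (∏ i, a (q.2 i)) *
        ‖∑ j, ((σ j : ℤ) : ℝ) • ((δ (q.1 j) - δ (q.2 j)) • x j)‖ ^ p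
      = ∑ q : (Fin n → ℤˣ) × (Fin n → ℤˣ), (∏ i, a (q.1 i)) * (∏ i, a (q.2 i)) *
        ‖∑ j, (δ (q.1 j) - δ (q.2 j)) • x j‖ ^ p := by
  let e : (Fin n → ℤˣ) × (Fin n → ℤˣ) → (Fin n → ℤˣ) × (Fin n → ℤˣ) := fun q =>
    (fun j => if σ j = 1 then q.1 j else q.2 j, fun j => if σ j = 1 then q.2 j else q.1 j)
  have he : Function.Involutive e := by
    rintro ⟨ξ, ζ⟩
    ext j <;> by_cases h : σ j = 1 <;> simp [e, h]
  refine Fintype.sum_equiv he.toPerm _ _ fun q => ?_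
  simp only [Function.Involutive.coe_toPerm]
  congr 1
  · rw [← prod_mul_distrib, ← prod_mul_distrib]
    refine prod_congr rfl fun j _ => ?_
    by_cases h : σ j = 1 <;> simp [e, h, mul_comm]
  · congr 2
    refine sum_congr rfl fun j _ => ?_
    rcases Int.units_eq_one_or (σ j) with h | h
    · simp [e, h]
    · simp only [e, h, show (-1 : ℤˣ) ≠ 1 by decide, if_false]
      push_cast
      module

/-- The type `p` inequality with random signs replaced by independent centred variables
`δ (ξ j)`, the `ξ j` being i.i.d. of law `a`. The cost is the factor `2 ^ p` of symmetrization and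
the `p`-th moment of `δ`. -/
theorem RademacherTypeWith.sum_centered_le {T : ℝ} (hT : 0 ≤ T) (hp : 1 ≤ p)
    (hX : RademacherTypeWith p T X) {n : ℕ} (a δ : ℤˣ → ℝ) (ha0 : ∀ t, 0 ≤ a t)
    (ha : ∑ t, a t = 1) (hδ : ∑ t, a t * δ t = 0) (x : Fin n → X) :
    ∑ ξ : Fin n → ℤˣ, (∏ i, a (ξ i)) * ‖∑ j, δ (ξ j) • x j‖ ^ p
      ≤ (2 * T) ^ p * (∑ t, a t * |δ t| ^ p) * ∑ j, ‖x j‖ ^ p := by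
  have hW : ∀ ξ : Fin n → ℤˣ, 0 ≤ ∏ i, a (ξ i) := fun ξ => prod_nonneg fun i _ => ha0 _
  -- As `δ` is centred, subtracting an independent copy inside a mean changes nothing.
  have h1 : ∀ ξ : Fin n → ℤˣ, ∑ j, δ (ξ j) • x j
      = ∑ ζ : Fin n → ℤˣ, (∏ i, a (ζ i)) • ∑ j, (δ (ξ j) - δ (ζ j)) • x j := by
    intro ξ
    simp_rw [smul_sum]
    rw [sum_comm]
    refine sum_congr rfl fun j _ => ?_
    simp_rw [smul_smul]
    rw [← sum_smul]
    congr 1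
    simp_rw [mul_sub]
    rw [sum_sub_distrib, ← sum_mul, sum_prod_eq_one a ha, sum_prod_mul_apply a δ ha, hδ]
    ring
  have h2 : ∑ ξ : Fin n → ℤˣ, (∏ i, a (ξ i)) * ‖∑ j, δ (ξ j) • x j‖ ^ p
      ≤ ∑ q : (Fin n → ℤˣ) × (Fin n → ℤˣ), (∏ i, a (q.1 i)) * (∏ i, a (q.2 i)) *
        ‖∑ j, (δ (q.1 j) - δ (q.2 j)) • x j‖ ^ p := by
    rw [Fintype.sum_prod_type]
    refine sum_le_sum fun ξ _ => ?_
    simp_rw [mul_assoc]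
    rw [← mul_sum]
    refine mul_le_mul_of_nonneg_left ?_ (hW ξ)
    conv_lhs => rw [h1 ξ]
    exact norm_rpow_sum_le univ hp _ (fun ζ _ => hW ζ) (sum_prod_eq_one a ha) _
  have h3 : ∑ q : (Fin n → ℤˣ) × (Fin n → ℤˣ), (∏ i, a (q.1 i)) * (∏ i, a (q.2 i)) *
        ‖∑ j, (δ (q.1 j) - δ (q.2 j)) • x j‖ ^ p
      = ∑ q : (Fin n → ℤˣ) × (Fin n → ℤˣ), (∏ i, a (q.1 i)) * (∏ i, a (q.2 i)) *
        Finset.expect Finset.univ (fun σ : Fin n → ℤˣ =>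
          ‖∑ j, ((σ j : ℤ) : ℝ) • ((δ (q.1 j) - δ (q.2 j)) • x j)‖ ^ p) := by
    simp_rw [mul_expect]
    rw [← expect_sum_comm]
    simp_rw [norm_signed_sum_rpow_eq]
    rw [expect_const univ_nonempty]
  have h4 : ∀ q : (Fin n → ℤˣ) × (Fin n → ℤˣ), (∏ i, a (q.1 i)) * (∏ i, a (q.2 i)) *
        Finset.expect Finset.univ (fun σ : Fin n → ℤˣ =>
          ‖∑ j, ((σ j : ℤ) : ℝ) • ((δ (q.1 j) - δ (q.2 j)) • x j)‖ ^ p)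
      ≤ (∏ i, a (q.1 i)) * (∏ i, a (q.2 i)) * (T ^ p * ∑ j, 2 ^ p *
        ((|δ (q.1 j)| ^ p + |δ (q.2 j)| ^ p) / 2) * ‖x j‖ ^ p) := by
    intro q
    refine mul_le_mul_of_nonneg_left ?_ (mul_nonneg (hW _) (hW _))
    refine (hX n _).trans (mul_le_mul_of_nonneg_left ?_ (by positivity))
    refine sum_le_sum fun j _ => ?_
    rw [norm_smul, Real.mul_rpow (norm_nonneg _) (norm_nonneg _)]
    exact mul_le_mul_of_nonneg_right (norm_sub_rpow_le hp _ _) (by positivity)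
  refine h2.trans (h3.le.trans ((sum_le_sum fun q _ => h4 q).trans (le_of_eq ?_)))
  have h5 : ∀ j : Fin n, ∑ q : (Fin n → ℤˣ) × (Fin n → ℤˣ), (∏ i, a (q.1 i)) *
      (∏ i, a (q.2 i)) * ((|δ (q.1 j)| ^ p + |δ (q.2 j)| ^ p) / 2) = ∑ t, a t * |δ t| ^ p := by
    intro j
    have e1 : ∑ q : (Fin n → ℤˣ) × (Fin n → ℤˣ), (∏ i, a (q.1 i)) *
        (∏ i, a (q.2 i)) * |δ (q.1 j)| ^ p = ∑ t, a t * |δ t| ^ p := by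
      rw [Fintype.sum_prod_type]
      simp_rw [mul_right_comm _ _ (|δ _| ^ p), ← mul_sum]
      rw [sum_prod_eq_one a ha]
      simp_rw [mul_one]
      exact sum_prod_mul_apply a (fun t => |δ t| ^ p) ha j
    have e2 : ∑ q : (Fin n → ℤˣ) × (Fin n → ℤˣ), (∏ i, a (q.1 i)) *
        (∏ i, a (q.2 i)) * |δ (q.2 j)| ^ p = ∑ t, a t * |δ t| ^ p := by
      rw [Fintype.sum_prod_type]
      simp_rw [mul_assoc, ← mul_sum]
      rw [sum_prod_mul_apply a (fun t => |δ t| ^ p) ha j, ← sum_mul, sum_prod_eq_one a ha, one_mul]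
    simp_rw [← mul_div_assoc, mul_add, ← sum_div, sum_add_distrib]
    rw [e1, e2]
    ring
  simp_rw [mul_sum]
  rw [sum_comm]
  refine sum_congr rfl fun j _ => ?_
  rw [← mul_sum, ← h5 j, mul_sum, sum_mul, Real.mul_rpow zero_le_two hT]
  refine sum_congr rfl fun q _ => ?_
  ring

/-! ### Biased signs and their scores -/

/-- The law of a single `±1`-valued variable with mean `r`. -/
noncomputable def bias (r : ℝ) (t : ℤˣ) : ℝ := (1 + r * ((t : ℤ) : ℝ)) / 2

/-- The score `∂_r log (bias r t)` of the biased sign; it is centred under `bias r`. -/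
noncomputable def score (r : ℝ) (t : ℤˣ) : ℝ := ((t : ℤ) : ℝ) / (1 + r * ((t : ℤ) : ℝ))

theorem sum_intUnits {M : Type*} [AddCommMonoid M] (g : ℤˣ → M) : ∑ t, g t = g 1 + g (-1) := by
  have : (univ : Finset ℤˣ) = {1, -1} := by decide
  rw [this, sum_pair (by decide)]

theorem bias_nonneg {r : ℝ} (h0 : 0 ≤ r) (h1 : r ≤ 1) (t : ℤˣ) : 0 ≤ bias r t := by
  rcases Int.units_eq_one_or t with rfl | rfl <;> simp [bias] <;> linarith

theorem sum_bias (r : ℝ) : ∑ t, bias r t = 1 := by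
  rw [sum_intUnits]; simp [bias]; ring

theorem bias_mul_score {r : ℝ} (h0 : 0 ≤ r) (h1 : r < 1) (t : ℤˣ) :
    bias r t * score r t = ((t : ℤ) : ℝ) / 2 := by
  rcases Int.units_eq_one_or t with rfl | rfl
  · have : 1 + r ≠ 0 := by linarith
    simp [bias, score]; field_simp
  · have : 1 - r ≠ 0 := by linarith
    simp [bias, score, ← sub_eq_add_neg]; field_simp

theorem sum_bias_mul_abs_score_rpow_le {r : ℝ} (h0 : 0 ≤ r) (h1 : r < 1) (hp : 1 ≤ p) :
    ∑ t, bias r t * |score r t| ^ p ≤ (1 - r) ^ (1 - p) := by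
  have key : ∀ s : ℝ, 0 < s → s / 2 * (s⁻¹) ^ p = s ^ (1 - p) / 2 := by
    intro s hs
    rw [Real.inv_rpow hs.le, Real.rpow_sub hs, Real.rpow_one]; ring
  have hs : 0 < 1 - r := by linarith
  have hs' : 0 < 1 + r := by linarith
  have e1 : bias r 1 * |score r 1| ^ p = (1 + r) ^ (1 - p) / 2 := by
    rw [← key _ hs']; simp [bias, score, abs_of_pos hs']
  have e2 : bias r (-1) * |score r (-1)| ^ p = (1 - r) ^ (1 - p) / 2 := by
    rw [← key _ hs]; simp [bias, score, ← sub_eq_add_neg, abs_div, abs_of_pos hs]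
  rw [sum_intUnits, e1, e2]
  have := Real.rpow_le_rpow_of_nonpos hs (by linarith : 1 - r ≤ 1 + r) (by linarith : 1 - p ≤ 0)
  linarith

/-! ### Enflo type inequality on the cube -/

/-- The sign vector that is `-1` at `j` and `1` elsewhere; multiplying by it flips the `j`-th
coordinate. -/
def signFlip {n : ℕ} (j : Fin n) : Fin n → ℤˣ := Pi.mulSingle j (-1)

/-- The discrete derivative of `f` in direction `j` on the cube, with the normalization `1 / 2`
for which `f ↦ cubeDeriv j f` is a projection. -/
noncomputable def cubeDeriv {n : ℕ} (j : Fin n) (f : (Fin n → ℤˣ) → X) (ε : Fin n → ℤˣ) : X :=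
  (1 / 2 : ℝ) • (f ε - f (ε * signFlip j))

theorem hasDerivAt_prod_bias {n : ℕ} {r : ℝ} (h0 : 0 ≤ r) (h1 : r < 1) (ξ : Fin n → ℤˣ) :
    HasDerivAt (fun s => ∏ i, bias s (ξ i)) (∑ j, (∏ i, bias r (ξ i)) * score r (ξ j)) r := by
  have hb : ∀ i, HasDerivAt (fun s => bias s (ξ i)) (((ξ i : ℤ) : ℝ) / 2) r := by
    intro i
    simpa [bias] using (((hasDerivAt_id r).mul_const ((ξ i : ℤ) : ℝ)).const_add 1).div_const 2
  refine (HasDerivAt.fun_finsetProd (u := univ) fun i _ => hb i).congr_deriv ?_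
  refine sum_congr rfl fun j _ => ?_
  rw [← bias_mul_score h0 h1, smul_eq_mul, ← mul_assoc, prod_erase_mul _ _ (mem_univ j)]

/-- The product of the density of `ξ` and the score of its `j`-th coordinate is odd in `ξ j`,
because `bias r t * score r t = t / 2`. -/
theorem prod_bias_mul_score_flip {n : ℕ} {r : ℝ} (h0 : 0 ≤ r) (h1 : r < 1) (ξ : Fin n → ℤˣ)
    (j : Fin n) : (∏ i, bias r ((ξ * signFlip j) i)) * score r ((ξ * signFlip j) j)
      = -((∏ i, bias r (ξ i)) * score r (ξ j)) := by
  rw [← prod_erase_mul _ _ (mem_univ j), ← prod_erase_mul univ (fun i => bias r (ξ i)) (mem_univ j),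
    mul_assoc, mul_assoc, bias_mul_score h0 h1, bias_mul_score h0 h1,
    prod_congr rfl (g := fun i => bias r (ξ i))]
  · simp [signFlip]; ring
  · intro i hi
    simp [signFlip, Pi.mulSingle_eq_of_ne (ne_of_mem_erase hi)]

/-- The derivative of the noise operator `r ↦ 𝔼 f (ε ξ)` is a mean of score-weighted sums of
discrete derivatives: oddness in `ξ j` allows replacing `f` by `cubeDeriv j f`. -/
theorem sum_prod_bias_mul_score_smul {n : ℕ} {r : ℝ} (h0 : 0 ≤ r) (h1 : r < 1)
    (f : (Fin n → ℤˣ) → X) (ε : Fin n → ℤˣ) :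
    ∑ ξ : Fin n → ℤˣ, (∑ j, (∏ i, bias r (ξ i)) * score r (ξ j)) • f (ε * ξ)
      = ∑ ξ : Fin n → ℤˣ, (∏ i, bias r (ξ i)) • ∑ j, score r (ξ j) • cubeDeriv j f (ε * ξ) := by
  simp_rw [sum_smul, smul_sum]
  rw [sum_comm]
  conv_rhs => rw [sum_comm]
  refine sum_congr rfl fun j _ => ?_
  have hflip : ∑ ξ : Fin n → ℤˣ, ((∏ i, bias r (ξ i)) * score r (ξ j)) • f (ε * ξ * signFlip j)
      = -∑ ξ : Fin n → ℤˣ, ((∏ i, bias r (ξ i)) * score r (ξ j)) • f (ε * ξ) := by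
    rw [← sum_neg_distrib]
    refine Fintype.sum_equiv (Equiv.mulRight (signFlip j)) _ _ fun ξ => ?_
    simp only [Equiv.coe_mulRight]
    rw [prod_bias_mul_score_flip h0 h1, neg_smul, neg_neg, mul_assoc]
  have : ∀ ξ : Fin n → ℤˣ, (∏ i, bias r (ξ i)) • score r (ξ j) • cubeDeriv j f (ε * ξ)
      = (1 / 2 : ℝ) • (((∏ i, bias r (ξ i)) * score r (ξ j)) • f (ε * ξ)
        - ((∏ i, bias r (ξ i)) * score r (ξ j)) • f (ε * ξ * signFlip j)) := by
    intro ξ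
    rw [cubeDeriv]; module
  simp_rw [this]
  rw [← smul_sum, sum_sub_distrib, hflip]
  module

/-- The `L_p` bound on the derivative of the noise operator. The point is that for uniform `ε`
independent of `ξ`, the product `ε * ξ` is again uniform and independent of `ξ`, so that the type
inequality applies with the vectors `cubeDeriv j f (ε * ξ)` frozen. -/
theorem RademacherTypeWith.sum_noise_deriv_le {T : ℝ} (hT : 0 ≤ T) (hp : 1 ≤ p)
    (hX : RademacherTypeWith p T X) {n : ℕ} {r : ℝ} (h0 : 0 ≤ r) (h1 : r < 1)
    (f : (Fin n → ℤˣ) → X) :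
    ∑ ε : Fin n → ℤˣ, ‖∑ ξ : Fin n → ℤˣ,
        (∑ j, (∏ i, bias r (ξ i)) * score r (ξ j)) • f (ε * ξ)‖ ^ p
      ≤ (2 * T) ^ p * (1 - r) ^ (1 - p) *
        ∑ ε : Fin n → ℤˣ, ∑ j, ‖cubeDeriv j f ε‖ ^ p := by
  have hW : ∀ ξ : Fin n → ℤˣ, 0 ≤ ∏ i, bias r (ξ i) :=
    fun ξ => prod_nonneg fun i _ => bias_nonneg h0 h1.le _
  simp_rw [sum_prod_bias_mul_score_smul h0 h1]
  calc _ ≤ ∑ ε : Fin n → ℤˣ, ∑ ξ : Fin n → ℤˣ, (∏ i, bias r (ξ i)) *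
          ‖∑ j, score r (ξ j) • cubeDeriv j f (ε * ξ)‖ ^ p :=
        sum_le_sum fun ε _ => norm_rpow_sum_le univ hp _ (fun ξ _ => hW ξ)
          (sum_prod_eq_one _ (sum_bias r)) _
    _ = ∑ η : Fin n → ℤˣ, ∑ ξ : Fin n → ℤˣ, (∏ i, bias r (ξ i)) *
          ‖∑ j, score r (ξ j) • cubeDeriv j f η‖ ^ p := by
        rw [sum_comm]
        conv_rhs => rw [sum_comm]
        refine sum_congr rfl fun ξ _ => ?_
        exact Fintype.sum_equiv (Equiv.mulRight ξ) _ _ fun ε => rfl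
    _ ≤ ∑ η : Fin n → ℤˣ, (2 * T) ^ p * (1 - r) ^ (1 - p) * ∑ j, ‖cubeDeriv j f η‖ ^ p := by
        refine sum_le_sum fun η _ => ?_
        refine (hX.sum_centered_le hT hp (bias r) (score r) (bias_nonneg h0 h1.le) (sum_bias r)
          ?_ _).trans ?_
        · simp_rw [bias_mul_score h0 h1]
          rw [sum_intUnits]; norm_num
        · gcongr
          exact sum_bias_mul_abs_score_rpow_le h0 h1 hp
    _ = _ := by rw [mul_sum]

/-- An `L_p` Poincaré inequality on the cube, obtained by integrating the derivative of the noise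
operator over `[0, 1]`. At `r = 0` the product measure `∏ i, bias 0 (ξ i)` is uniform. -/
theorem RademacherTypeWith.sum_norm_sub_mean_rpow_le {T : ℝ} (hT : 0 ≤ T) (hp : 1 ≤ p)
    (hX : RademacherTypeWith p T X) {n : ℕ} (f : (Fin n → ℤˣ) → X) :
    ∑ ε : Fin n → ℤˣ, ‖f ε - ∑ ξ : Fin n → ℤˣ, (∏ i, bias 0 (ξ i)) • f (ε * ξ)‖ ^ p
      ≤ (2 * p * T) ^ p * ∑ ε : Fin n → ℤˣ, ∑ j, ‖cubeDeriv j f ε‖ ^ p := by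
  have hp0 : 0 < p := by linarith
  have : Fact (1 ≤ ENNReal.ofReal p) := ⟨by simpa using ENNReal.ofReal_le_ofReal hp⟩
  have hpt : (ENNReal.ofReal p).toReal = p := ENNReal.toReal_ofReal hp0.le
  have hnorm : ∀ F : PiLp (ENNReal.ofReal p) fun _ : Fin n → ℤˣ => X,
      ‖F‖ = (∑ ε, ‖F ε‖ ^ p) ^ (1 / p) := by
    intro F
    rw [PiLp.norm_eq_sum (by rw [hpt]; exact hp0), hpt]
  set A := ∑ ε : Fin n → ℤˣ, ∑ j, ‖cubeDeriv j f ε‖ ^ p with hA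
  have hA0 : 0 ≤ A := by positivity
  let V : (Fin n → ℤˣ) → PiLp (ENNReal.ofReal p) fun _ : Fin n → ℤˣ => X :=
    fun ξ => WithLp.toLp _ fun ε => f (ε * ξ)
  let G : ℝ → PiLp (ENNReal.ofReal p) fun _ : Fin n → ℤˣ => X :=
    fun r => ∑ ξ, (∏ i, bias r (ξ i)) • V ξ
  let G' : ℝ → PiLp (ENNReal.ofReal p) fun _ : Fin n → ℤˣ => X :=
    fun r => ∑ ξ, (∑ j, (∏ i, bias r (ξ i)) * score r (ξ j)) • V ξ
  have hG : ∀ r, 0 ≤ r → r < 1 → HasDerivAt G (G' r) r := fun r h0 h1 =>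
    HasDerivAt.fun_sum fun ξ _ => (hasDerivAt_prod_bias h0 h1 ξ).smul_const (V ξ)
  have hGc : Continuous G := by
    have : ∀ ξ : Fin n → ℤˣ, Continuous fun r => ∏ i, bias r (ξ i) := by
      unfold bias
      fun_prop
    exact continuous_finsetSum _ fun ξ _ => (this ξ).smul continuous_const
  -- `B` is the primitive vanishing at `0` of the bound `M * (1 - r) ^ (1 / p - 1)` on `‖G' r‖`.
  -- The bound may blow up at `r = 1`, but `B` is continuous there.
  let M : ℝ := 2 * T * A ^ (1 / p)
  let B : ℝ → ℝ := fun r => M * p * (1 - (1 - r) ^ (1 / p))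
  have hB : ∀ r, r < 1 → HasDerivAt B (M * (1 - r) ^ (1 / p - 1)) r := by
    intro r h1
    have := (((hasDerivAt_id r).const_sub 1).rpow_const (p := 1 / p)
      (Or.inl (by simp; linarith))).const_sub 1 |>.const_mul (M * p)
    refine this.congr_deriv ?_
    simp only [id]
    field_simp
  have hBc : Continuous B := by
    have : Continuous fun r : ℝ => (1 - r) ^ (1 / p) :=
      (continuous_const.sub continuous_id).rpow_const fun r => Or.inr (by positivity)
    exact continuous_const.mul (continuous_const.sub this)
  have hbound : ∀ r ∈ Set.Ico (0 : ℝ) 1, ‖G' r‖ ≤ M * (1 - r) ^ (1 / p - 1) := by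
    rintro r ⟨h0, h1⟩
    have hr : 0 < 1 - r := by linarith
    have e : M * (1 - r) ^ (1 / p - 1) = ((2 * T) ^ p * (1 - r) ^ (1 - p) * A) ^ (1 / p) := by
      rw [Real.mul_rpow (by positivity) hA0, Real.mul_rpow (by positivity) (by positivity),
        ← Real.rpow_mul (by positivity), ← Real.rpow_mul hr.le, mul_one_div_cancel hp0.ne',
        Real.rpow_one, sub_mul, mul_one_div_cancel hp0.ne', one_mul]
      ring
    rw [e, hnorm]
    refine Real.rpow_le_rpow (by positivity) ?_ (by positivity)
    simpa [G', V] using hX.sum_noise_deriv_le hT hp h0 h1 f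
  have key : ‖G 1 - G 0‖ ≤ B 1 := by
    refine image_norm_le_of_norm_deriv_right_le_deriv_boundary' (f := fun r => G r - G 0)
      (f' := G') (a := 0) (b := 1) (B := B) (B' := fun r => M * (1 - r) ^ (1 / p - 1))
      (hGc.sub continuous_const).continuousOn
      (fun r hr => ((hG r hr.1 hr.2).sub_const _).hasDerivWithinAt) ?_
      hBc.continuousOn (fun r hr => (hB r hr.2).hasDerivWithinAt) hbound
      (Set.right_mem_Icc.2 zero_le_one)
    simp [B]
  have hG1 : G 1 = V 1 := by
    simp only [G]
    rw [sum_eq_single 1]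
    · simp [bias]
    · intro ξ _ hξ
      obtain ⟨j, hj⟩ := Function.ne_iff.1 hξ
      have : ξ j = -1 := (Int.units_eq_one_or _).resolve_left hj
      rw [prod_eq_zero (mem_univ j) (by simp [bias, this]), zero_smul]
    · simp
  have hB1 : B 1 = 2 * p * T * A ^ (1 / p) := by
    simp only [B, M, sub_self]
    rw [Real.zero_rpow (by positivity)]; ring
  rw [hnorm, hB1, hG1] at key
  have := Real.rpow_le_rpow (by positivity) key hp0.le
  rw [← Real.rpow_mul (by positivity), one_div_mul_cancel hp0.ne', Real.rpow_one,
    Real.mul_rpow (by positivity) (by positivity), ← Real.rpow_mul hA0,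
    one_div_mul_cancel hp0.ne', Real.rpow_one] at this
  simpa [G, V] using this

/-- Rademacher type `p` implies Enflo type `p` on the cube. -/
theorem RademacherTypeWith.sum_norm_sub_neg_rpow_le {T : ℝ} (hT : 0 ≤ T) (hp : 1 ≤ p)
    (hX : RademacherTypeWith p T X) {n : ℕ} (f : (Fin n → ℤˣ) → X) :
    ∑ ε : Fin n → ℤˣ, ‖f ε - f (-ε)‖ ^ p
      ≤ (4 * p * T) ^ p * ∑ ε : Fin n → ℤˣ, ∑ j, ‖cubeDeriv j f ε‖ ^ p := by
  set m : X := ∑ ξ : Fin n → ℤˣ, (∏ i : Fin n, (1 / 2 : ℝ)) • f ξ with hm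
  have hmean : ∀ ε : Fin n → ℤˣ, ∑ ξ : Fin n → ℤˣ, (∏ i, bias 0 (ξ i)) • f (ε * ξ) = m := by
    intro ε
    refine Fintype.sum_equiv (Equiv.mulLeft ε) _ _ fun ξ => ?_
    simp [bias]
  have h := hX.sum_norm_sub_mean_rpow_le hT hp f
  simp_rw [hmean] at h
  have hneg : ∑ ε : Fin n → ℤˣ, ‖f (-ε) - m‖ ^ p = ∑ ε : Fin n → ℤˣ, ‖f ε - m‖ ^ p :=
    Fintype.sum_equiv (Equiv.neg _) _ _ fun ε => rfl
  calc ∑ ε : Fin n → ℤˣ, ‖f ε - f (-ε)‖ ^ p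
      ≤ ∑ ε : Fin n → ℤˣ, 2 ^ p * ((‖f ε - m‖ ^ p + ‖f (-ε) - m‖ ^ p) / 2) := by
        refine sum_le_sum fun ε _ => ?_
        rw [← sub_sub_sub_cancel_right _ _ m]
        exact norm_sub_rpow_le hp _ _
    _ = 2 ^ p * ∑ ε : Fin n → ℤˣ, ‖f ε - m‖ ^ p := by
        rw [← mul_sum, ← sum_div, sum_add_distrib, hneg]; ring
    _ ≤ 2 ^ p * ((2 * p * T) ^ p * ∑ ε : Fin n → ℤˣ, ∑ j, ‖cubeDeriv j f ε‖ ^ p) := by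
        gcongr
    _ = _ := by
        rw [← mul_assoc, ← Real.mul_rpow zero_le_two (by positivity)]
        ring_nf

/-! ### Transfer to the torus -/

theorem signVec_neg {n m : ℕ} (ε : Fin n → ℤˣ) : signVec m (-ε) = -signVec m ε := by
  ext j; simp [signVec]

section Torus

variable {n m : ℕ} [NeZero m]

/-- `smoothing` is an average of translations, hence contracts `L_p` norms. -/
theorem sum_norm_smoothing_sub_rpow_le (hp : 1 ≤ p) (k : ℕ) (hk : 0 < k)
    (f : (Fin n → ZMod m) → X) (u v : Fin n → ZMod m) :
    ∑ x, ‖smoothing k univ f (x + u) - smoothing k univ f (x + v)‖ ^ p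
      ≤ ∑ x, ‖f (x + u) - f (x + v)‖ ^ p := by
  set L : Finset (Fin n → ZMod m) := evenBox k univ with hL
  have h0 : (0 : Fin n → ZMod m) ∈ L := by
    simp only [hL, evenBox, mem_filter]
    simpa [torusDist, Finset.sup_lt_iff hk] using fun _ => hk
  have hc : (0 : ℝ) < L.card := by exact_mod_cast card_pos.2 ⟨0, h0⟩
  calc ∑ x, ‖smoothing k univ f (x + u) - smoothing k univ f (x + v)‖ ^ p
      ≤ ∑ x, ∑ y ∈ L, (L.card : ℝ)⁻¹ * ‖f (x + u + y) - f (x + v + y)‖ ^ p := by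
        refine sum_le_sum fun x _ => ?_
        rw [smoothing, smoothing, ← smul_sub, ← sum_sub_distrib, smul_sum]
        exact norm_rpow_sum_le L hp _ (fun _ _ => by positivity) (by
          rw [sum_const, nsmul_eq_mul, mul_inv_cancel₀ hc.ne']) _
    _ = ∑ y ∈ L, (L.card : ℝ)⁻¹ * ∑ x, ‖f (x + u) - f (x + v)‖ ^ p := by
        rw [sum_comm]
        refine sum_congr rfl fun y _ => ?_
        rw [← mul_sum]
        congr 1
        refine Fintype.sum_equiv (Equiv.addRight y) _ _ fun x => ?_
        simp only [Equiv.coe_addRight, add_right_comm]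
    _ = _ := by
        rw [sum_const, nsmul_eq_mul, mul_inv_cancel_left₀ hc.ne']

theorem sum_norm_add_single_sub_rpow_le (hp : 1 ≤ p) (f : (Fin n → ZMod m) → X) (j : Fin n) :
    ∑ x : Fin n → ZMod m, ‖f (x + Pi.single j 1) - f (x - Pi.single j 1)‖ ^ p
      ≤ 2 ^ p * ∑ x, ‖f (x + Pi.single j 1) - f x‖ ^ p := by
  have hs : ∑ x : Fin n → ZMod m, ‖f (x - Pi.single j 1) - f x‖ ^ p
      = ∑ x, ‖f (x + Pi.single j 1) - f x‖ ^ p := by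
    refine Fintype.sum_equiv (Equiv.subRight (Pi.single j 1)) _ _ fun x => ?_
    simp [norm_sub_rev]
  calc _ ≤ ∑ x : Fin n → ZMod m, 2 ^ p * ((‖f (x + Pi.single j 1) - f x‖ ^ p
          + ‖f (x - Pi.single j 1) - f x‖ ^ p) / 2) := by
        refine sum_le_sum fun x _ => ?_
        rw [← sub_sub_sub_cancel_right _ _ (f x)]
        exact norm_sub_rpow_le hp _ _
    _ = _ := by
        rw [← mul_sum, ← sum_div, sum_add_distrib, hs]; ring

theorem sum_norm_sub_flip_rpow_le (hp : 1 ≤ p) (f : (Fin n → ZMod m) → X) (ε : Fin n → ℤˣ)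
    (j : Fin n) :
    ∑ x, ‖f (x + signVec m ε) - f (x + signVec m (ε * signFlip j))‖ ^ p
      ≤ 2 ^ p * ∑ x, ‖f (x + Pi.single j 1) - f x‖ ^ p := by
  refine le_trans (le_of_eq ?_) (sum_norm_add_single_sub_rpow_le hp f j)
  -- With `w` the part of `signVec m ε` off `j`, the two points are `x + w ± Pi.single j 1`.
  set w : Fin n → ZMod m := Function.update (signVec m ε) j 0 with hw
  have h : ∀ ζ : Fin n → ℤˣ, (∀ i ≠ j, ζ i = ε i) →
      signVec m ζ = w + Pi.single j (((ζ j : ℤ) : ZMod m)) := by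
    intro ζ hζ
    ext i
    by_cases hi : i = j
    · subst hi; simp [hw, signVec]
    · simp [hw, signVec, hi, hζ i hi]
  have h1 := h ε fun _ _ => rfl
  have h2 := h (ε * signFlip j) fun i hi => by simp [signFlip, Pi.mulSingle_eq_of_ne hi]
  refine Fintype.sum_equiv (Equiv.addRight w) _ _ fun x => ?_
  rw [h1, h2]
  rcases Int.units_eq_one_or (ε j) with he | he
  · simp [signFlip, he, add_assoc, sub_eq_add_neg, Pi.single_neg]
  · rw [norm_sub_rev]
    simp [signFlip, he, add_assoc, sub_eq_add_neg, Pi.single_neg]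

theorem RademacherTypeWith.sum_norm_smoothing_sub_rpow_le {T : ℝ} (hT : 0 ≤ T) (hp : 1 ≤ p)
    (hX : RademacherTypeWith p T X) (k : ℕ) (hk : 0 < k) (f : (Fin n → ZMod m) → X) :
    ∑ x, ∑ ε : Fin n → ℤˣ, ‖smoothing k univ f (x + signVec m ε)
        - smoothing k univ f (x - signVec m ε)‖ ^ p
      ≤ Fintype.card (Fin n → ℤˣ) * ((4 * p * T) ^ p *
          ∑ j, ∑ x, ‖f (x + Pi.single j 1) - f x‖ ^ p) := by
  calc _ ≤ ∑ x, (4 * p * T) ^ p * ∑ ε : Fin n → ℤˣ, ∑ j,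
          ‖cubeDeriv j (fun ζ => smoothing k univ f (x + signVec m ζ)) ε‖ ^ p := by
        refine sum_le_sum fun x _ => ?_
        have := hX.sum_norm_sub_neg_rpow_le hT hp
          fun ζ : Fin n → ℤˣ => smoothing k univ f (x + signVec m ζ)
        simpa only [signVec_neg, ← sub_eq_add_neg] using this
    _ = (4 * p * T) ^ p * ∑ ε : Fin n → ℤˣ, ∑ j, ∑ x,
          ‖cubeDeriv j (fun ζ => smoothing k univ f (x + signVec m ζ)) ε‖ ^ p := by
        rw [← mul_sum, sum_comm]
        simp_rw [sum_comm (s := (univ : Finset (Fin n → ZMod m)))]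
    _ ≤ (4 * p * T) ^ p * ∑ _ε : Fin n → ℤˣ, ∑ j, ∑ x, ‖f (x + Pi.single j 1) - f x‖ ^ p := by
        refine mul_le_mul_of_nonneg_left ?_ (by positivity)
        refine sum_le_sum fun ε _ => sum_le_sum fun j _ => ?_
        have h := (ScaledEnflo.sum_norm_smoothing_sub_rpow_le hp k hk f (signVec m ε)
          (signVec m (ε * signFlip j))).trans (sum_norm_sub_flip_rpow_le hp f ε j)
        simp_rw [cubeDeriv, norm_smul, Real.mul_rpow (norm_nonneg _) (norm_nonneg _)]
        rw [← mul_sum]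
        calc _ ≤ ‖(1 / 2 : ℝ)‖ ^ p * (2 ^ p * ∑ x, ‖f (x + Pi.single j 1) - f x‖ ^ p) := by gcongr
          _ = _ := by
            rw [← mul_assoc, ← Real.mul_rpow (norm_nonneg _) zero_le_two]
            norm_num
    _ = _ := by
        rw [sum_const, nsmul_eq_mul, card_univ]; ring

end Torus

end ScaledEnflo

theorem lemma3p2 (c : ℝ) (hc : 0 < c) :
    ∃ K : ℝ → ℝ → ℝ,
      ∀ (X : Type*) [NormedAddCommGroup X] [NormedSpace ℝ X] [CompleteSpace X] (p : ℝ),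
        ScaledEnflo.HasRademacherType p X →
        ∀ (n m : ℕ) [NeZero m] (k : ℕ), Even m → Odd k → 2 * k < m →
          c * (n * Real.log n) ≤ k →
          ∀ f : (Fin n → ZMod m) → X,
            Finset.expect Finset.univ (fun x : Fin n → ZMod m =>
              Finset.expect Finset.univ (fun ε : Fin n → ℤˣ =>
                ‖ScaledEnflo.smoothing k Finset.univ f (x + ScaledEnflo.signVec m ε)
                  - ScaledEnflo.smoothing k Finset.univ f (x - ScaledEnflo.signVec m ε)‖ ^ p))
            ≤ K p (ScaledEnflo.rademacherConst p X) *
                ∑ j : Fin n, Finset.expect Finset.univ (fun x : Fin n → ZMod m =>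
                  ‖f (x + Pi.single j 1) - f x‖ ^ p) := by
  refine ⟨fun p T => (4 * p * T) ^ p, ?_⟩
  intro X _ _ _ p hX n m _ k _ hk _ _ f
  obtain ⟨hT, hType⟩ := hX.isLeast.1
  have h := hType.sum_norm_smoothing_sub_rpow_le hT hX.1 k hk.pos f
  have hN : (0 : ℝ) < Fintype.card (Fin n → ℤˣ) := by exact_mod_cast Fintype.card_pos
  have hM : (0 : ℝ) ≤ Fintype.card (Fin n → ZMod m) := Nat.cast_nonneg _
  simp_rw [Fintype.expect_eq_sum_div_card]
  rw [← sum_div, ← sum_div, ← mul_div_assoc]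
  exact div_le_div_of_nonneg_right ((div_le_iff₀' hN).2 h) hM
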